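/- Let $K$ be a field, $R=K[x_1,\dots,x_n]$, $\mathfrak m=(x_1,\dots,x_n)$, and let $I\subset R$ be a matroidal ideal of degree $2$. That is, $I$ is a monomial ideal whose minimal monomial generating set $G(I)$ consists of square-free monomials of degree $2$ and has the exchange property: whenever $u,v\in G(I)$ and $\deg_{x_i}(u)>\deg_{x_i}(v)$ for some $i$, there is $j$ with $\deg_{x_j}(u)<\deg_{x_j}(v)$ and $x_j(u/x_i)\in I$. Let $\operatorname{astab}(I)$ be the smallest integer $k_0\ge 1$ such that $\operatorname{Ass}(R/I^k)=\operatorname{Ass}(R/I^{k_0})$ for all $k\ge k_0$, and let $\operatorname{dstab}(I)$ be the smallest integer $k_0\ge 1$ such that $\operatorname{depth} R/I^k=\operatorname{depth} R/I^{k_0}$ for all $k\ge k_0$, where $\operatorname{depth} M$ is the maximal length of an $M$-regular sequence contained in $\mathfrak m$. Then $$\operatorname{astab}(I)=\operatorname{dstab}(I)\le 2.$$ -/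

import Mathlib

namespace PolymatroidalStability

open MvPolynomial

variable {n : ℕ} {K : Type*} [Field K]

/-- `I` is a monomial ideal: it is generated by a set of monomials. A monomial `x ^ a` is
represented by its exponent vector `a`. -/
def IsMonomialIdeal (I : Ideal (MvPolynomial (Fin n) K)) : Prop :=
  ∃ S : Set (Fin n →₀ ℕ), I = Ideal.span ((fun a => monomial a (1 : K)) '' S)

/-- The (exponent vectors of the) minimal monomial generators `G(I)` of a monomial ideal `I`:
the monomials of `I` that are minimal for divisibility. -/
def minGens (I : Ideal (MvPolynomial (Fin n) K)) : Set (Fin n →₀ ℕ) :=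
  {a | Minimal (fun b => monomial b (1 : K) ∈ I) a}

/-- `I` is a polymatroidal ideal of degree `d`: a monomial ideal generated in the single degree
`d` with the exchange property: if `u, v ∈ G(I)` and `deg_{x_i} u > deg_{x_i} v`, then there is `j`
with `deg_{x_j} u < deg_{x_j} v` and `x_j (u / x_i) ∈ I`. -/
structure IsPolymatroidal (I : Ideal (MvPolynomial (Fin n) K)) (d : ℕ) : Prop where
  monomial_ideal : IsMonomialIdeal I
  degree_eq : ∀ u ∈ minGens I, u.degree = d
  exchange : ∀ u ∈ minGens I, ∀ v ∈ minGens I, ∀ i, v i < u i →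
    ∃ j, u j < v j ∧
      monomial (u - Finsupp.single i 1 + Finsupp.single j 1) (1 : K) ∈ I

/-- `I` is a matroidal ideal of degree `d`: polymatroidal of degree `d` and generated by
square-free monomials. -/
structure IsMatroidal (I : Ideal (MvPolynomial (Fin n) K)) (d : ℕ) : Prop extends
    IsPolymatroidal I d where
  squarefree : ∀ u ∈ minGens I, ∀ i, u i ≤ 1

/-- The depth of a module `M` with respect to an ideal `J`: the supremum of the lengths of the
`M`-regular sequences contained in `J`. -/
noncomputable def depth {R : Type*} [CommRing R] (J : Ideal R)
    (M : Type*) [AddCommGroup M] [Module R M] : ℕ∞ :=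
  ⨆ rs ∈ {rs : List R | (∀ r ∈ rs, r ∈ J) ∧ RingTheory.Sequence.IsRegular M rs},
    (rs.length : ℕ∞)

/-- The homogeneous maximal ideal `𝔪 = (x_1, …, x_n)` of `K[x_1, …, x_n]`. -/
noncomputable def irrelevantIdeal (n : ℕ) (K : Type*) [Field K] :
    Ideal (MvPolynomial (Fin n) K) :=
  Ideal.span (Set.range X)

/-- The index of stability of a sequence `f 1, f 2, …`: the least `k ≥ 1` with `f l = f k` for all
`l ≥ k`. It is `⊤` if the sequence does not stabilize. -/
noncomputable def stabIndex {α : Type*} (f : ℕ → α) : ℕ∞ :=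
  ⨅ k ∈ {k : ℕ | 1 ≤ k ∧ ∀ l, k ≤ l → f l = f k}, (k : ℕ∞)

/-- The index of `Ass`-stability of `I`, where `Ass(I ^ k)` is the set of associated primes of
the module `R / I ^ k`. -/
noncomputable def astab (I : Ideal (MvPolynomial (Fin n) K)) : ℕ∞ :=
  stabIndex fun k => associatedPrimes (MvPolynomial (Fin n) K) (MvPolynomial (Fin n) K ⧸ I ^ k)

/-- The index of depth stability of `I`, for the sequence `depth R / I ^ k`. -/
noncomputable def dstab (I : Ideal (MvPolynomial (Fin n) K)) : ℕ∞ :=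
  stabIndex fun k => depth (irrelevantIdeal n K) (MvPolynomial (Fin n) K ⧸ I ^ k)

end PolymatroidalStability

/-!
A matroidal ideal `I` of degree `2` is the edge ideal of a graph `G` that is complete multipartite
on its set `V` of non-isolated vertices: the exchange property says that non-adjacency is transitive
on `V` (`IsMatroidal.eq_edgeIdeal`, `IsMatroidal.isMultipartiteOnSupport`). Write `P_F` for the prime
ideal generated by the variables in `F ⊆ V` and `N(v)` for the neighbours of `v`. The powers of
`P_F` are primary, because `P_F ^ k` consists of the polynomials of order at least `k` in the
variables of `F` (`mem_varIdeal_pow_iff`).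

Associated primes. If an associated prime of `R / I ^ k` omits `x_v` with `v ∈ V`, it equals
`P_{N(v)}`, since inverting `x_v` turns `I` into `P_{N(v)}`; if it omits none, it equals `P_V`, since
the other variables do not occur in `I`. All `P_{N(v)}` are associated to all powers, so the question
is whether `P_V` is.

* If `G` has an edge and `k = 1` or `G` has no triangle, then `I ^ k` is the intersection of the
  `P_{N(v)} ^ k` (`powEqInf_one`, `powEqInf_of_triangleFree`). So the sum `θ` of the variables of `V`
  is a nonzerodivisor modulo `I ^ k`, and `P_V` is not associated.
* If `abc` is a triangle and `k ≥ 2`, then `x_a x_b x_c (x_a x_b) ^ (k - 2)` has degree `2 k - 1`,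
  hence is not in `I ^ k`, but every variable of `V` multiplies it into `I ^ k`. So `P_V` is
  associated.

Depth. Let `ℓ` be the number of isolated vertices; their variables form a regular sequence modulo
`I ^ k`. In the first case above they can be preceded by `θ`, and an explicit socle element shows
that the resulting sequence of length `ℓ + 1` is maximal (`PowEqInf.depth_eq`). In the second case
they already form a maximal regular sequence (`depth_of_triangle`). That the length of one maximal
regular sequence is the depth follows from the theorem of Rees (`depth_quotient_eq_add_one`).

Consequently both sequences are constant if `G` has no edge or no triangle, and otherwise both
change from `k = 1` to `k = 2` and are constant from there on.
-/

namespace PolymatroidalStability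

open MvPolynomial

/-! ### Depth of cyclic modules -/

section Depth

universe u

open CategoryTheory Abelian RingTheory.Sequence Pointwise

variable {R : Type u} [CommRing R]

lemma depth_eq_iSup (J : Ideal R) (M : Type*) [AddCommGroup M] [Module R M] :
    depth J M = ⨆ (rs : List R) (_ : (∀ r ∈ rs, r ∈ J) ∧ IsRegular M rs), (rs.length : ℕ∞) := by
  simp only [depth, Set.mem_ofPred_eq]

lemma depth_congr {J : Ideal R} {M N : Type*} [AddCommGroup M] [Module R M] [AddCommGroup N]
    [Module R N] (e : M ≃ₗ[R] N) : depth J M = depth J N := by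
  simp only [depth_eq_iSup, e.isRegular_congr]

/-- A nonzerodivisor `a` on `M`, not only the first term of the given sequence, leaves room for a
regular sequence on `M / aM` that is shorter by one: by the theorem of Rees both lengths are
governed by the vanishing of `Ext (R ⧸ J)`, and the long exact sequence of
`0 → M → M → M / aM → 0` shifts degrees by one. -/
lemma exists_isRegular_quotSMulTop [IsNoetherianRing R] {J : Ideal R} {M : Type u}
    [AddCommGroup M] [Module R M] [Module.Finite R M] (hJ : J • (⊤ : Submodule R M) < ⊤)
    {a : R} (ha : IsSMulRegular M a) (hJa : J • (⊤ : Submodule R (QuotSMulTop a M)) < ⊤)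
    {rs : List R} (hrs : ∀ r ∈ rs, r ∈ J) (hreg : IsRegular M rs) {t : ℕ}
    (ht : rs.length = t + 1) :
    ∃ rs' : List R, rs'.length = t ∧ (∀ r ∈ rs', r ∈ J) ∧ IsRegular (QuotSMulTop a M) rs' := by
  have ext_eq : ∀ i < t + 1, Subsingleton
      (Ext (ModuleCat.of R (Shrink.{u} (R ⧸ J))) (ModuleCat.of R M) i) := by
    have h := (ModuleCat.exists_isRegular_tfae J (t + 1) (ModuleCat.of R M) hJ).out 3 1
    exact h.1 ⟨rs, ht, hrs, hreg⟩
  have reg_of_ext : (∀ i < t, Subsingleton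
      (Ext (ModuleCat.of R (Shrink.{u} (R ⧸ J))) (ModuleCat.of R (QuotSMulTop a M)) i)) →
      ∃ rs' : List R, rs'.length = t ∧ (∀ r ∈ rs', r ∈ J) ∧ IsRegular (QuotSMulTop a M) rs' := by
    have h := (ModuleCat.exists_isRegular_tfae J t (ModuleCat.of R (QuotSMulTop a M)) hJa).out 1 3
    exact h.1
  refine reg_of_ext fun i hi => ?_
  have zero1 := AddCommGrpCat.isZero_of_iff_subsingleton.mpr (ext_eq i (by omega))
  have zero2 := AddCommGrpCat.isZero_of_iff_subsingleton.mpr (ext_eq (i + 1) (by omega))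
  exact AddCommGrpCat.subsingleton_of_isZero <| ShortComplex.Exact.isZero_of_both_zeros
    (Ext.covariant_sequence_exact₃' _
      (IsSMulRegular.smulShortComplex_shortExact (M := ModuleCat.of R M) ha) i (i + 1) rfl)
    (zero1.eq_zero_of_src _) (zero2.eq_zero_of_tgt _)

/-- The isomorphism `(R / 𝔞) / a (R / 𝔞) ≃ R / (𝔞 + (a))`. -/
noncomputable def quotSMulTopQuotientEquiv (𝔞 : Ideal R) (a : R) :
    QuotSMulTop a (R ⧸ 𝔞) ≃ₗ[R] R ⧸ (𝔞 ⊔ Ideal.span {a}) :=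
  (Submodule.quotEquivOfEq _ _ (by
    rw [← Submodule.ideal_span_singleton_smul, ← Submodule.range_mkQ 𝔞, ← Submodule.map_top,
      ← Submodule.map_smul'', smul_eq_mul, Ideal.mul_top])) ≪≫ₗ
    Submodule.quotientQuotientEquivQuotientSup 𝔞 (Ideal.span {a})

lemma isSMulRegular_quotient_iff {𝔞 : Ideal R} {a : R} :
    IsSMulRegular (R ⧸ 𝔞) a ↔ ∀ f, a * f ∈ 𝔞 → f ∈ 𝔞 := by
  rw [isSMulRegular_quotient_iff_mem_of_smul_mem]
  rfl

lemma smul_top_lt_top_of_surjective {J : Ideal R} {M : Type*} [AddCommGroup M] [Module R M]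
    (f : R →ₗ[R] M) (hf : Function.Surjective f) (h : J ⊔ LinearMap.ker f ≠ ⊤) :
    J • (⊤ : Submodule R M) < ⊤ := by
  refine lt_top_iff_ne_top.2 fun hJ => h ?_
  have := Submodule.comap_smul_top_of_surjective J f hf
  rwa [hJ, Submodule.comap_top, smul_eq_mul, Ideal.mul_top, eq_comm] at this

/-- A socle element `u` shows that `J` contains no nonzerodivisor modulo `𝔞`. -/
lemma depth_quotient_eq_zero {J 𝔞 : Ideal R} {u : R} (hu : u ∉ 𝔞) (h : ∀ r ∈ J, r * u ∈ 𝔞) :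
    depth J (R ⧸ 𝔞) = 0 := by
  rw [depth_eq_iSup]
  refine le_antisymm (iSup₂_le ?_) bot_le
  rintro (_ | ⟨r, rs⟩) ⟨hrs, hreg⟩
  · simp
  · rw [isRegular_cons_iff, isSMulRegular_quotient_iff] at hreg
    exact absurd (hreg.1 u (h r (hrs r (by simp)))) hu

/-- Dividing out a nonzerodivisor in `J` lowers the depth by exactly one. -/
lemma depth_quotient_eq_add_one [IsNoetherianRing R] {J 𝔞 : Ideal R} (hJ : 𝔞 ⊔ J ≠ ⊤) {a : R}
    (haJ : a ∈ J) (ha : ∀ f, a * f ∈ 𝔞 → f ∈ 𝔞) :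
    depth J (R ⧸ 𝔞) = depth J (R ⧸ (𝔞 ⊔ Ideal.span {a})) + 1 := by
  have e := quotSMulTopQuotientEquiv 𝔞 a
  rw [← depth_congr e, depth_eq_iSup, depth_eq_iSup]
  have hreg := isSMulRegular_quotient_iff.2 ha
  have hJ' : J ⊔ (𝔞 ⊔ Ideal.span {a}) ≠ ⊤ := by
    rwa [sup_comm 𝔞, ← sup_assoc, sup_eq_left.2 ((Ideal.span_singleton_le_iff_mem J).2 haJ),
      sup_comm]
  have hJa : J • (⊤ : Submodule R (QuotSMulTop a (R ⧸ 𝔞))) < ⊤ :=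
    smul_top_lt_top_of_surjective (e.symm.toLinearMap ∘ₗ Submodule.mkQ _)
      (e.symm.surjective.comp (Submodule.mkQ_surjective _))
      (by rwa [LinearEquiv.ker_comp, Submodule.ker_mkQ])
  apply le_antisymm
  · refine iSup₂_le fun rs hrs => ?_
    rcases ht : rs.length with _ | t
    · simp
    · obtain ⟨rs', hl, hrs'⟩ := exists_isRegular_quotSMulTop (smul_top_lt_top_of_surjective _
        (Submodule.mkQ_surjective 𝔞) (by rwa [Submodule.ker_mkQ, sup_comm])) hreg
        hJa hrs.1 hrs.2 ht
      rw [← hl]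
      push_cast
      gcongr
      exact le_iSup₂_of_le rs' hrs' le_rfl
  · have : Nontrivial (QuotSMulTop a (R ⧸ 𝔞)) :=
      (Submodule.nontrivial_iff R).1 (nontrivial_of_lt _ _ hJa)
    rw [ENat.biSup_add' ⟨[], by simp, IsRegular.nil _ _⟩]
    refine iSup₂_le fun rs hrs => le_iSup₂_of_le (a :: rs) ⟨?_, hrs.2.cons hreg⟩ (by simp)
    simpa [haJ] using hrs.1

end Depth

/-! ### Prime ideals generated by variables, and monomial ideals -/

section MonomialIdeals

variable {σ : Type*} {K : Type*} [Field K]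

variable (K) in
/-- The monomial prime ideal `P_F` generated by the variables in `F`. -/
noncomputable def varIdeal (F : Set σ) : Ideal (MvPolynomial σ K) :=
  Ideal.span (X '' F)

lemma X_mem_varIdeal_iff {F : Set σ} {v : σ} : (X v : MvPolynomial σ K) ∈ varIdeal K F ↔ v ∈ F := by
  classical
  rw [varIdeal, mem_ideal_span_X_image]
  simp [support_X, Finsupp.single_apply]

lemma varIdeal_mono {F F' : Set σ} (h : F ⊆ F') : varIdeal K F ≤ varIdeal K F' :=
  Ideal.span_mono (Set.image_mono h)

lemma varIdeal_le_iff {F : Set σ} {J : Ideal (MvPolynomial σ K)} :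
    varIdeal K F ≤ J ↔ ∀ v ∈ F, X v ∈ J := by
  rw [varIdeal, Ideal.span_le, Set.image_subset_iff]
  rfl

/-- The weight that counts the variables in `F`, so that `Finsupp.weight (indicatorWeight F) m` is
the degree of the monomial `m` in these variables. -/
noncomputable def indicatorWeight (F : Set σ) : σ → ℕ :=
  F.indicator 1

lemma monomial_mem_varIdeal_pow {F : Set σ} (m : σ →₀ ℕ) (c : K) {k : ℕ}
    (hk : k ≤ Finsupp.weight (indicatorWeight F) m) : monomial m c ∈ varIdeal K F ^ k := by
  have key : (monomial m 1 : MvPolynomial σ K) ∈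
      varIdeal K F ^ Finsupp.weight (indicatorWeight F) m := by
    clear hk
    induction m using Finsupp.induction_linear with
    | zero => simp
    | add f g hf hg =>
      rw [map_add, pow_add, ← one_mul (1 : K), ← monomial_mul]
      exact Ideal.mul_mem_mul hf hg
    | single i d =>
      by_cases hi : i ∈ F
      · have : (X i : MvPolynomial σ K) ^ d ∈ varIdeal K F ^ d :=
          Ideal.pow_mem_pow (X_mem_varIdeal_iff.2 hi) d
        simpa [Finsupp.weight_apply, indicatorWeight, hi, X_pow_eq_monomial] using this
      · simp [Finsupp.weight_apply, indicatorWeight, hi]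
  rw [← mul_one c, ← C_mul_monomial]
  exact Ideal.mul_mem_left _ _ (Ideal.pow_le_pow_right hk key)

/-- Membership in `P_F ^ k` is a condition on the order with respect to the variables in `F`; since
the order is additive on products, this makes `P_F ^ k` a primary ideal. -/
lemma mem_varIdeal_pow_iff {F : Set σ} {k : ℕ} {f : MvPolynomial σ K} :
    f ∈ varIdeal K F ^ k ↔
      k ≤ (f : MvPowerSeries σ K).weightedOrder (indicatorWeight F) := by
  constructor
  · intro h
    induction k generalizing f with
    | zero => simp
    | succ k ih =>
      rw [pow_succ] at h
      induction h using Submodule.mul_induction_on' with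
      | mem_mul_mem g hg x hx =>
        rw [coe_mul, MvPowerSeries.weightedOrder_mul, Nat.cast_succ]
        refine add_le_add (ih hg) (MvPowerSeries.nat_le_weightedOrder _ fun d hd => ?_)
        rw [coeff_coe]
        by_contra hne
        obtain ⟨i, hi, hdi⟩ := mem_ideal_span_X_image.1 hx d (mem_support_iff.2 hne)
        have := Finsupp.le_weight (indicatorWeight F) (s := i) (by simp [indicatorWeight, hi]) d
        omega
      | add x _ y _ hx hy =>
        rw [coe_add]
        exact (le_min hx hy).trans (MvPowerSeries.min_weightedOrder_le_add _)
  · intro h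
    rw [f.as_sum]
    refine Ideal.sum_mem _ fun m hm => monomial_mem_varIdeal_pow m _ ?_
    have hm' : MvPowerSeries.coeff m (f : MvPowerSeries σ K) ≠ 0 := by
      rwa [coeff_coe, ← mem_support_iff]
    exact_mod_cast h.trans (MvPowerSeries.weightedOrder_le _ hm')

lemma mem_varIdeal_pow_of_mul_mem {F : Set σ} {k : ℕ} {f g : MvPolynomial σ K}
    (hg : g ∉ varIdeal K F) (h : g * f ∈ varIdeal K F ^ k) : f ∈ varIdeal K F ^ k := by
  rw [← pow_one (varIdeal K F), mem_varIdeal_pow_iff, Nat.cast_one,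
    Order.one_le_iff_ne_zero, not_not] at hg
  rw [mem_varIdeal_pow_iff] at h ⊢
  rwa [coe_mul, MvPowerSeries.weightedOrder_mul, hg, zero_add] at h

lemma weight_le_of_mem_varIdeal_pow {F : Set σ} {k : ℕ} {f : MvPolynomial σ K}
    (hf : f ∈ varIdeal K F ^ k) {m : σ →₀ ℕ} (hm : m ∈ f.support) :
    k ≤ Finsupp.weight (indicatorWeight F) m := by
  have hm' : MvPowerSeries.coeff m (f : MvPowerSeries σ K) ≠ 0 := by
    rwa [coeff_coe, ← mem_support_iff]
  exact_mod_cast (mem_varIdeal_pow_iff.1 hf).trans (MvPowerSeries.weightedOrder_le _ hm')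

lemma isPrime_varIdeal (F : Set σ) : (varIdeal K F).IsPrime := by
  refine ⟨fun h => ?_, fun {x y} hxy => or_iff_not_imp_left.2 fun hx => ?_⟩
  · rw [varIdeal, Ideal.eq_top_iff_one, mem_ideal_span_X_image] at h
    simpa using h 0 (by simp)
  · rw [← pow_one (varIdeal K F)] at hxy ⊢
    exact mem_varIdeal_pow_of_mul_mem hx hxy

/-- A polynomial is free of the variable `y` if multiplication by it commutes with the division by
`y` that discards the monomials not divisible by `y`. -/
def FreeOfVar (y : σ) (g : MvPolynomial σ K) : Prop :=
  ∀ f, (g * f).divMonomial (Finsupp.single y 1) = g * f.divMonomial (Finsupp.single y 1)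

/-- An ideal is free of the variable `y` if it is generated by polynomials that are. -/
def IdealFreeOfVar (y : σ) (J : Ideal (MvPolynomial σ K)) : Prop :=
  ∃ S : Set (MvPolynomial σ K), (∀ g ∈ S, FreeOfVar y g) ∧ J = Ideal.span S

lemma freeOfVar_X {y v : σ} (h : v ≠ y) : FreeOfVar y (X v : MvPolynomial σ K) := by
  classical
  intro f
  ext a
  rw [coeff_divMonomial, coeff_X_mul', coeff_X_mul', coeff_divMonomial]
  have : v ∈ (Finsupp.single y 1 + a).support ↔ v ∈ a.support := by
    simp [h.symm]
  simp only [this]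
  split_ifs with hv
  · congr 1
    ext w
    simp only [Finsupp.add_apply, Finsupp.tsub_apply, Finsupp.single_apply]
    have : v ∈ a.support → 1 ≤ a v := by simp [Nat.one_le_iff_ne_zero]
    grind
  · rfl

lemma FreeOfVar.mul {y : σ} {g h : MvPolynomial σ K} (hg : FreeOfVar y g) (hh : FreeOfVar y h) :
    FreeOfVar y (g * h) := fun f => by rw [mul_assoc, hg, hh, mul_assoc]

lemma FreeOfVar.sum {ι : Type*} {y : σ} {s : Finset ι} {g : ι → MvPolynomial σ K}
    (hg : ∀ i ∈ s, FreeOfVar y (g i)) : FreeOfVar y (∑ i ∈ s, g i) := by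
  classical
  induction s using Finset.induction_on with
  | empty => intro f; simp
  | insert a s ha ih =>
    intro f
    rw [Finset.sum_insert ha, add_mul, add_divMonomial, hg a (by simp),
      ih (fun i hi => hg i (by simp [hi])), add_mul]

lemma idealFreeOfVar_varIdeal {y : σ} {F : Set σ} (h : y ∉ F) :
    IdealFreeOfVar y (varIdeal K F) := by
  refine ⟨X '' F, ?_, rfl⟩
  rintro _ ⟨v, hv, rfl⟩
  exact freeOfVar_X (by rintro rfl; exact h hv)

lemma IdealFreeOfVar.sup {y : σ} {I J : Ideal (MvPolynomial σ K)} (hI : IdealFreeOfVar y I)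
    (hJ : IdealFreeOfVar y J) : IdealFreeOfVar y (I ⊔ J) := by
  obtain ⟨S, hS, rfl⟩ := hI
  obtain ⟨T, hT, rfl⟩ := hJ
  exact ⟨S ∪ T, fun g hg => hg.elim (hS g) (hT g), (Ideal.span_union S T).symm⟩

open Pointwise in
lemma IdealFreeOfVar.pow {y : σ} {I : Ideal (MvPolynomial σ K)} (hI : IdealFreeOfVar y I) (k : ℕ) :
    IdealFreeOfVar y (I ^ k) := by
  induction k with
  | zero => exact ⟨{1}, by simp [FreeOfVar], by simp⟩
  | succ k ih =>
    obtain ⟨S, hS, rfl⟩ := hI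
    obtain ⟨T, hT, hTk⟩ := ih
    refine ⟨T * S, ?_, by rw [pow_succ, hTk, Ideal.span_mul_span']⟩
    rintro _ ⟨t, ht, s, hs, rfl⟩
    exact (hT t ht).mul (hS s hs)

/-- A variable that does not occur in generators of `J` is a nonzerodivisor modulo `J`. -/
lemma IdealFreeOfVar.mem_of_X_mul_mem {y : σ} {J : Ideal (MvPolynomial σ K)}
    (hJ : IdealFreeOfVar y J) {f : MvPolynomial σ K} (h : X y * f ∈ J) : f ∈ J := by
  obtain ⟨S, hS, rfl⟩ := hJ
  have key : ∀ f ∈ Ideal.span S, ∀ h : MvPolynomial σ K,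
      (f * h).divMonomial (Finsupp.single y 1) ∈ Ideal.span S := by
    intro f hf
    induction hf using Submodule.span_induction with
    | mem g hg =>
      intro h
      rw [hS g hg]
      exact Ideal.mul_mem_right _ _ (Ideal.subset_span hg)
    | zero => simp
    | add f g _ _ hf hg =>
      intro h
      rw [add_mul, add_divMonomial]
      exact add_mem (hf h) (hg h)
    | smul a f _ ih =>
      intro h
      rw [smul_eq_mul, mul_comm a, mul_assoc]
      exact ih _
  simpa [X_mul_divMonomial] using key _ h 1

lemma IdealFreeOfVar.mem_of_monomial_mul_mem {F : Set σ} {J : Ideal (MvPolynomial σ K)}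
    (hJ : ∀ y ∈ F, IdealFreeOfVar y J) {b : σ →₀ ℕ} (hb : ∀ y ∈ b.support, y ∈ F)
    {f : MvPolynomial σ K} (h : monomial b 1 * f ∈ J) : f ∈ J := by
  have hX : ∀ y ∈ F, ∀ (d : ℕ) (f : MvPolynomial σ K), X y ^ d * f ∈ J → f ∈ J := by
    intro y hy d
    induction d with
    | zero => simp
    | succ d ih =>
      intro f hf
      rw [pow_succ, mul_assoc] at hf
      exact (hJ y hy).mem_of_X_mul_mem (ih _ hf)
  rw [monomial_eq, C_1, one_mul, Finsupp.prod] at h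
  have key : ∀ s : Finset σ, (∀ y ∈ s, y ∈ F) → (∏ y ∈ s, X y ^ b y) * f ∈ J → f ∈ J := by
    classical
    intro s
    induction s using Finset.induction_on with
    | empty => simp
    | insert a s ha ih =>
      intro hs h
      rw [Finset.prod_insert ha, mul_assoc] at h
      exact ih (fun y hy => hs y (by simp [hy])) (hX a (hs a (by simp)) _ _ h)
  exact key _ hb h

/-- The ideal `J` is generated by monomials. -/
def SpannedByMonomials (J : Ideal (MvPolynomial σ K)) : Prop :=
  ∃ S : Set (σ →₀ ℕ), J = Ideal.span ((fun a => monomial a (1 : K)) '' S)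

lemma SpannedByMonomials.monomial_mem {J : Ideal (MvPolynomial σ K)} (hJ : SpannedByMonomials J)
    {f : MvPolynomial σ K} (hf : f ∈ J) {a : σ →₀ ℕ} (ha : a ∈ f.support) : monomial a 1 ∈ J := by
  classical
  obtain ⟨S, rfl⟩ := hJ
  rw [mem_ideal_span_monomial_image] at hf ⊢
  intro b hb
  obtain rfl : b = a := by simpa [support_monomial] using hb
  exact hf b ha

open Pointwise in
lemma SpannedByMonomials.pow {J : Ideal (MvPolynomial σ K)} (hJ : SpannedByMonomials J) (k : ℕ) :
    SpannedByMonomials (J ^ k) := by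
  induction k with
  | zero => exact ⟨{0}, by simp⟩
  | succ k ih =>
    obtain ⟨S, rfl⟩ := hJ
    obtain ⟨T, hT⟩ := ih
    refine ⟨T + S, ?_⟩
    rw [pow_succ, hT, Ideal.span_mul_span']
    exact congrArg Ideal.span (Set.image_image2_distrib fun a b => by
      rw [monomial_mul, one_mul]).symm

/-- If `J` is a monomial ideal in the variables of `V` and `V` annihilates a nonzero element `f` of
`R / J`, then no polynomial outside `P_V` annihilates `f`: modulo `P_V` such a polynomial only
involves variables on which `R / J` is torsion-free. -/
lemma mem_varIdeal_of_mul_mem {V : Set σ} {J : Ideal (MvPolynomial σ K)}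
    (hmon : SpannedByMonomials J) (hfree : ∀ y ∈ Vᶜ, IdealFreeOfVar y J)
    {f g : MvPolynomial σ K} (hf : f ∉ J) (hV : ∀ v ∈ V, X v * f ∈ J) (hg : g * f ∈ J) :
    g ∈ varIdeal K V := by
  classical
  by_contra hgV
  -- Only the part `f₂` of `f` with no monomial in `J` matters.
  let f₁ := ∑ a ∈ f.support with monomial a (1 : K) ∈ J, monomial a (f.coeff a)
  let f₂ := ∑ a ∈ f.support with monomial a (1 : K) ∉ J, monomial a (f.coeff a)
  have hf₁ : f₁ ∈ J := Ideal.sum_mem _ fun a ha => by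
    rw [← mul_one (f.coeff a), ← C_mul_monomial]
    exact Ideal.mul_mem_left _ _ (Finset.mem_filter.1 ha).2
  have hff : f = f₁ + f₂ := by
    rw [Finset.sum_filter_add_sum_filter_not]
    exact f.as_sum
  have hsupp : ∀ a ∈ f₂.support, monomial a (1 : K) ∉ J := by
    intro a ha
    obtain ⟨b, hb, hab⟩ := Finset.mem_biUnion.1 (support_sum ha)
    rw [Finset.mem_singleton.1 (support_monomial_subset hab)]
    exact (Finset.mem_filter.1 hb).2
  have hf₂ : f₂ ≠ 0 := fun h => hf (by rwa [hff, h, add_zero])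
  have hmul : ∀ p, p * f ∈ J → p * f₂ ∈ J := fun p hp => by
    have := sub_mem hp (Ideal.mul_mem_left _ p hf₁)
    rwa [hff, mul_add, add_sub_cancel_left] at this
  -- Likewise only the part `g₂` of `g` free of the variables in `V` matters.
  let g₁ := ∑ a ∈ g.support with ∃ i ∈ V, a i ≠ 0, monomial a (g.coeff a)
  let g₂ := ∑ a ∈ g.support with ¬ ∃ i ∈ V, a i ≠ 0, monomial a (g.coeff a)
  have hgg : g = g₁ + g₂ := by
    rw [Finset.sum_filter_add_sum_filter_not]
    exact g.as_sum
  have hg₁ : g₁ ∈ varIdeal K V := Ideal.sum_mem _ fun a ha => by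
    rw [varIdeal, mem_ideal_span_X_image]
    intro m hm
    rw [Finset.mem_singleton.1 (support_monomial_subset hm)]
    exact (Finset.mem_filter.1 ha).2
  have hg₂ : g₂ ≠ 0 := fun h => hgV (by rwa [hgg, h, add_zero])
  have hVf : varIdeal K V ≤ Submodule.colon J {f₂} :=
    varIdeal_le_iff.2 fun v hv => Submodule.mem_colon_singleton.2 (hmul _ (hV v hv))
  have hg₂f : g₂ * f₂ ∈ J := by
    have := sub_mem (hmul g hg) (Submodule.mem_colon_singleton.1 (hVf hg₁))
    rwa [hgg, smul_eq_mul, ← sub_mul, add_sub_cancel_left] at this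
  -- A monomial of `g₂ * f₂` lies in `J`; its variables outside `V` can be cancelled.
  obtain ⟨c, hc⟩ := support_nonempty.2 (mul_ne_zero hg₂ hf₂)
  obtain ⟨b, hb, a, ha, rfl⟩ := Finset.mem_add.1 (support_mul _ _ hc)
  have hcJ := hmon.monomial_mem hg₂f hc
  rw [← one_mul (1 : K), ← monomial_mul] at hcJ
  refine hsupp a ha (IdealFreeOfVar.mem_of_monomial_mul_mem hfree (fun y hy hyV => ?_) hcJ)
  obtain ⟨b', hb', hbb⟩ := Finset.mem_biUnion.1 (support_sum hb)
  rw [Finset.mem_singleton.1 (support_monomial_subset hbb)] at hy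
  exact (Finset.mem_filter.1 hb').2 ⟨y, hyV, Finsupp.mem_support_iff.1 hy⟩

variable (σ K) in
lemma varIdeal_univ : varIdeal K Set.univ = idealOfVars σ K := by
  rw [varIdeal, Set.image_univ]

lemma idealOfVars_ne_top : idealOfVars σ K ≠ ⊤ := by
  rw [← varIdeal_univ]
  exact (isPrime_varIdeal _).ne_top

lemma varIdeal_le_idealOfVars (F : Set σ) : varIdeal K F ≤ idealOfVars σ K := by
  rw [← varIdeal_univ]
  exact varIdeal_mono (Set.subset_univ _)

/-- The variables that do not occur in `𝔞` form a regular sequence modulo `𝔞`. -/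
lemma depth_quotient_eq_add_card [Finite σ] {𝔞 : Ideal (MvPolynomial σ K)}
    (h𝔞 : 𝔞 ≤ idealOfVars σ K) (L : Finset σ) (hL : ∀ y ∈ L, IdealFreeOfVar y 𝔞) :
    depth (idealOfVars σ K) (MvPolynomial σ K ⧸ 𝔞) =
      depth (idealOfVars σ K) (MvPolynomial σ K ⧸ (𝔞 ⊔ varIdeal K (L : Set σ))) + L.card := by
  classical
  induction L using Finset.induction_on with
  | empty =>
    rw [show 𝔞 ⊔ varIdeal K ((∅ : Finset σ) : Set σ) = 𝔞 by simp [varIdeal]]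
    simp
  | insert y L hy ih =>
    have hfree : IdealFreeOfVar y (𝔞 ⊔ varIdeal K (L : Set σ)) :=
      (hL y (by simp)).sup (idealFreeOfVar_varIdeal (by simpa using hy))
    rw [ih fun v hv => hL v (by simp [hv]),
      depth_quotient_eq_add_one (a := X y) _ (Ideal.subset_span (Set.mem_range_self y))
        fun f hf => hfree.mem_of_X_mul_mem hf, Finset.card_insert_of_notMem hy, sup_assoc]
    · have : varIdeal K (L : Set σ) ⊔ Ideal.span {X y} = varIdeal K (insert y L : Finset σ) := by
        rw [varIdeal, varIdeal, ← Ideal.span_union, Finset.coe_insert, Set.image_insert_eq,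
          Set.union_singleton]
      rw [this]
      push_cast
      ring
    · rw [sup_eq_right.2 (sup_le h𝔞 (varIdeal_le_idealOfVars _))]
      exact idealOfVars_ne_top

lemma mem_associatedPrimes_quotient_iff {R : Type*} [CommRing R] [IsNoetherianRing R]
    {𝔞 Q : Ideal R} :
    Q ∈ associatedPrimes R (R ⧸ 𝔞) ↔ Q.IsPrime ∧ ∃ f, ∀ g, g ∈ Q ↔ g * f ∈ 𝔞 := by
  rw [AssociatedPrimes.mem_iff, isAssociatedPrime_iff, (Ideal.Quotient.mk_surjective).exists]
  refine and_congr_right fun _ => exists_congr fun f => ?_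
  rw [SetLike.ext_iff]
  refine forall_congr' fun g => ?_
  rw [Submodule.mem_colon_singleton, Submodule.mem_bot, ← Ideal.Quotient.eq_zero_iff_mem (I := 𝔞),
    map_mul, Algebra.smul_def, Ideal.Quotient.algebraMap_eq]

end MonomialIdeals

/-! ### Edge ideals of complete multipartite graphs -/

section EdgeIdeals

variable {σ : Type*} {K : Type*} [Field K] {G : SimpleGraph σ}

variable (K) in
/-- The edge ideal of a graph, generated by the products `x_u x_v` over the edges `uv`. -/
noncomputable def edgeIdeal (G : SimpleGraph σ) : Ideal (MvPolynomial σ K) :=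
  Ideal.span ((fun p : σ × σ => X p.1 * X p.2) '' {p | G.Adj p.1 p.2})

/-- The graph is complete multipartite on its non-isolated vertices, that is, non-adjacency is
transitive there; it is stated in contrapositive form. -/
def IsMultipartiteOnSupport (G : SimpleGraph σ) : Prop :=
  ∀ ⦃u v w⦄, u ∈ G.support → G.Adj v w → G.Adj u v ∨ G.Adj u w

lemma X_mul_X_mem_edgeIdeal {u v : σ} (h : G.Adj u v) : X u * X v ∈ edgeIdeal K G :=
  Ideal.subset_span ⟨(u, v), h, rfl⟩

lemma edgeIdeal_le_iff {J : Ideal (MvPolynomial σ K)} :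
    edgeIdeal K G ≤ J ↔ ∀ u v, G.Adj u v → X u * X v ∈ J := by
  rw [edgeIdeal, Ideal.span_le, Set.image_subset_iff]
  exact ⟨fun h u v huv => h (a := (u, v)) huv, fun h p hp => h p.1 p.2 hp⟩

lemma spannedByMonomials_edgeIdeal : SpannedByMonomials (edgeIdeal K G) := by
  refine ⟨(fun p : σ × σ => Finsupp.single p.1 1 + Finsupp.single p.2 1) ''
    {p | G.Adj p.1 p.2}, ?_⟩
  rw [Set.image_image]
  simp [edgeIdeal, X, monomial_mul]

lemma idealFreeOfVar_edgeIdeal {y : σ} (hy : y ∉ G.support) :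
    IdealFreeOfVar y (edgeIdeal K G) := by
  refine ⟨_, ?_, rfl⟩
  rintro _ ⟨⟨u, v⟩, huv, rfl⟩
  have huv : G.Adj u v := huv
  refine (freeOfVar_X ?_).mul (freeOfVar_X ?_)
  · rintro rfl
    exact hy ⟨v, huv⟩
  · rintro rfl
    exact hy ⟨u, huv.symm⟩

lemma edgeIdeal_le_varIdeal_neighborSet (hG : IsMultipartiteOnSupport G) {v : σ}
    (hv : v ∈ G.support) : edgeIdeal K G ≤ varIdeal K (G.neighborSet v) := by
  refine edgeIdeal_le_iff.2 fun a b hab => ?_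
  obtain h | h := hG hv hab
  · exact Ideal.mul_mem_right _ _ (X_mem_varIdeal_iff.2 h)
  · exact Ideal.mul_mem_left _ _ (X_mem_varIdeal_iff.2 h)

lemma edgeIdeal_le_varIdeal_support_sq : edgeIdeal K G ≤ varIdeal K G.support ^ 2 := by
  refine edgeIdeal_le_iff.2 fun a b hab => ?_
  rw [pow_two]
  exact Ideal.mul_mem_mul (X_mem_varIdeal_iff.2 ⟨b, hab⟩) (X_mem_varIdeal_iff.2 ⟨a, hab.symm⟩)

lemma edgeIdeal_pow_le_varIdeal_support_pow (k : ℕ) :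
    edgeIdeal K G ^ k ≤ varIdeal K G.support ^ (2 * k) := by
  rw [pow_mul]
  exact Ideal.pow_right_mono edgeIdeal_le_varIdeal_support_sq k

lemma varIdeal_pow_le_idealOfVars_pow (F : Set σ) (k : ℕ) :
    varIdeal K F ^ k ≤ idealOfVars σ K ^ k :=
  Ideal.pow_right_mono (varIdeal_le_idealOfVars F) k

lemma edgeIdeal_pow_le_idealOfVars_pow (k : ℕ) :
    edgeIdeal K G ^ k ≤ idealOfVars σ K ^ (2 * k) :=
  (edgeIdeal_pow_le_varIdeal_support_pow k).trans (varIdeal_pow_le_idealOfVars_pow _ _)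

lemma edgeIdeal_pow_le_idealOfVars {k : ℕ} (hk : 1 ≤ k) :
    edgeIdeal K G ^ k ≤ idealOfVars σ K :=
  (edgeIdeal_pow_le_idealOfVars_pow k).trans (Ideal.pow_le_self (by omega))

/-- Inverting `x_v` turns the edge ideal into the prime ideal of the neighbours of `v`. -/
lemma X_pow_mul_mem_edgeIdeal_pow {v : σ} {k : ℕ} {f : MvPolynomial σ K}
    (hf : f ∈ varIdeal K (G.neighborSet v) ^ k) : X v ^ k * f ∈ edgeIdeal K G ^ k := by
  have h : Ideal.span {X v} * varIdeal K (G.neighborSet v) ≤ edgeIdeal K G := by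
    rw [varIdeal, Ideal.span_mul_span', Ideal.span_le]
    rintro _ ⟨_, rfl, _, ⟨w, hw, rfl⟩, rfl⟩
    exact X_mul_X_mem_edgeIdeal hw
  have := Ideal.pow_right_mono h k
  rw [mul_pow] at this
  exact this (Ideal.mul_mem_mul (Ideal.pow_mem_pow (Ideal.mem_span_singleton_self _) k) hf)

/-- The substitution `x_v ↦ c_v t`. -/
noncomputable def lineSubst (c : σ → K) : MvPolynomial σ K →ₐ[K] Polynomial K :=
  aeval fun v => Polynomial.C (c v) * Polynomial.X

lemma lineSubst_X (c : σ → K) (v : σ) :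
    lineSubst c (X v) = Polynomial.C (c v) * Polynomial.X := by
  simp [lineSubst]

lemma X_pow_dvd_lineSubst (c : σ → K) {k : ℕ} {f : MvPolynomial σ K}
    (hf : f ∈ idealOfVars σ K ^ k) : Polynomial.X ^ k ∣ lineSubst c f := by
  have h : idealOfVars σ K ≤ (Ideal.span {Polynomial.X}).comap (lineSubst c) := by
    rw [Ideal.span_le]
    rintro _ ⟨v, rfl⟩
    rw [SetLike.mem_coe, Ideal.mem_comap, lineSubst_X, Ideal.mem_span_singleton]
    exact dvd_mul_left _ _
  rw [← Ideal.mem_span_singleton, ← Ideal.span_singleton_pow, ← Ideal.mem_comap]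
  exact Ideal.le_comap_pow _ _ (Ideal.pow_right_mono h k hf)

lemma not_X_pow_dvd_X_pow {i j : ℕ} (h : j < i) :
    ¬ (Polynomial.X : Polynomial K) ^ i ∣ Polynomial.X ^ j := by
  rw [pow_dvd_pow_iff Polynomial.X_ne_zero Polynomial.not_isUnit_X]
  omega

lemma varIdeal_neighborSet_mem_associatedPrimes [Finite σ] (hG : IsMultipartiteOnSupport G)
    {v : σ} (hv : v ∈ G.support) {k : ℕ} (hk : 1 ≤ k) :
    varIdeal K (G.neighborSet v) ∈ associatedPrimes (MvPolynomial σ K)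
      (MvPolynomial σ K ⧸ edgeIdeal K G ^ k) := by
  obtain ⟨w, hw⟩ := hv
  obtain ⟨j, rfl⟩ := Nat.exists_eq_add_of_le' hk
  refine mem_associatedPrimes_quotient_iff.2
    ⟨isPrime_varIdeal _, X v ^ (j + 1) * X w ^ j, fun g => ⟨fun hg => ?_, fun hg => ?_⟩⟩
  · have h : g * (X v ^ (j + 1) * X w ^ j) = (X v * X w) ^ j * (X v ^ 1 * g) := by ring
    rw [h, pow_succ (edgeIdeal K G)]
    refine Ideal.mul_mem_mul (Ideal.pow_mem_pow (X_mul_X_mem_edgeIdeal hw) j) ?_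
    rw [← pow_one (edgeIdeal K G)]
    exact X_pow_mul_mem_edgeIdeal_pow (by rwa [pow_one])
  · by_contra hgP
    have h := mem_varIdeal_pow_of_mul_mem hgP
      (Ideal.pow_right_mono (edgeIdeal_le_varIdeal_neighborSet hG ⟨w, hw⟩) _ hg)
    have hvP : (X v : MvPolynomial σ K) ^ (j + 1) ∉ varIdeal K (G.neighborSet v) := fun h' =>
      G.irrefl (X_mem_varIdeal_iff.1 ((isPrime_varIdeal _).mem_of_pow_mem _ h'))
    have h := X_pow_dvd_lineSubst (fun _ => 1)
      (varIdeal_pow_le_idealOfVars_pow _ _ (mem_varIdeal_pow_of_mul_mem hvP h))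
    rw [map_pow, lineSubst_X, Polynomial.C_1, one_mul] at h
    exact not_X_pow_dvd_X_pow (by omega) h

/-- If three pairwise adjacent vertices exist, then from the second power on the element
`x_a x_b x_c (x_a x_b) ^ (k - 2)` of degree `2 k - 1` is multiplied into `I ^ k` by every
non-isolated variable. -/
lemma X_mul_triangle_mem_edgeIdeal_pow (hG : IsMultipartiteOnSupport G) {a b c : σ}
    (hab : G.Adj a b) (hbc : G.Adj b c) (hac : G.Adj a c) {v : σ} (hv : v ∈ G.support) (j : ℕ) :
    X v * (X a * X b * X c * (X a * X b) ^ j) ∈ edgeIdeal K G ^ (j + 2) := by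
  have key : X v * (X a * X b * X c) ∈ edgeIdeal K G ^ 2 := by
    rw [pow_two]
    obtain h | h := hG hv hab
    · rw [show (X v * (X a * X b * X c) : MvPolynomial σ K) = X v * X a * (X b * X c) by ring]
      exact Ideal.mul_mem_mul (X_mul_X_mem_edgeIdeal h) (X_mul_X_mem_edgeIdeal hbc)
    · rw [show (X v * (X a * X b * X c) : MvPolynomial σ K) = X v * X b * (X a * X c) by ring]
      exact Ideal.mul_mem_mul (X_mul_X_mem_edgeIdeal h) (X_mul_X_mem_edgeIdeal hac)
  rw [← mul_assoc, add_comm j 2, pow_add]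
  exact Ideal.mul_mem_mul key (Ideal.pow_mem_pow (X_mul_X_mem_edgeIdeal hab) j)

lemma lineSubst_triangle {γ : σ → K} {a b c : σ} (ha : γ a = 1) (hb : γ b = 1) (hc : γ c = 1)
    (j : ℕ) : lineSubst γ (X a * X b * X c * (X a * X b) ^ j) = Polynomial.X ^ (2 * j + 3) := by
  simp only [map_mul, map_pow, lineSubst_X, ha, hb, hc, Polynomial.C_1]
  ring

lemma varIdeal_support_mem_associatedPrimes [Finite σ] (hG : IsMultipartiteOnSupport G)
    {a b c : σ} (hab : G.Adj a b) (hbc : G.Adj b c) (hac : G.Adj a c) {k : ℕ} (hk : 2 ≤ k) :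
    varIdeal K G.support ∈ associatedPrimes (MvPolynomial σ K)
      (MvPolynomial σ K ⧸ edgeIdeal K G ^ k) := by
  obtain ⟨j, rfl⟩ := Nat.exists_eq_add_of_le' hk
  refine mem_associatedPrimes_quotient_iff.2
    ⟨isPrime_varIdeal _, X a * X b * X c * (X a * X b) ^ j, fun g => ⟨fun hg => ?_, fun hg => ?_⟩⟩
  · have h : varIdeal K G.support ≤
        Submodule.colon (edgeIdeal K G ^ (j + 2)) {X a * X b * X c * (X a * X b) ^ j} :=
      varIdeal_le_iff.2 fun v hv => Submodule.mem_colon_singleton.2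
        (X_mul_triangle_mem_edgeIdeal_pow hG hab hbc hac hv j)
    exact Submodule.mem_colon_singleton.1 (h hg)
  · by_contra hgP
    have h := mem_varIdeal_pow_of_mul_mem hgP (edgeIdeal_pow_le_varIdeal_support_pow _ hg)
    have h := X_pow_dvd_lineSubst (fun _ => 1) (varIdeal_pow_le_idealOfVars_pow _ _ h)
    rw [lineSubst_triangle (a := a) (b := b) (c := c) rfl rfl rfl] at h
    exact not_X_pow_dvd_X_pow (by omega) h

lemma eq_varIdeal_neighborSet_of_mem_associatedPrimes [Finite σ] (hG : IsMultipartiteOnSupport G)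
    {k : ℕ} {Q : Ideal (MvPolynomial σ K)}
    (hQ : Q ∈ associatedPrimes (MvPolynomial σ K) (MvPolynomial σ K ⧸ edgeIdeal K G ^ k))
    {v : σ} (hv : v ∈ G.support) (hvQ : X v ∉ Q) : Q = varIdeal K (G.neighborSet v) := by
  obtain ⟨hprime, f, hf⟩ := mem_associatedPrimes_quotient_iff.1 hQ
  have hIQ : edgeIdeal K G ≤ Q :=
    hprime.le_of_pow_le (n := k) fun g hg => (hf g).2 (Ideal.mul_mem_right _ _ hg)
  refine le_antisymm (fun g hg => ?_) (varIdeal_le_iff.2 fun u hu => ?_)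
  · by_contra hgP
    have h := mem_varIdeal_pow_of_mul_mem hgP
      (Ideal.pow_right_mono (edgeIdeal_le_varIdeal_neighborSet hG hv) _ ((hf g).1 hg))
    exact hvQ (hprime.mem_of_pow_mem k ((hf _).2 (X_pow_mul_mem_edgeIdeal_pow h)))
  · exact (hprime.mem_or_mem (hIQ (X_mul_X_mem_edgeIdeal hu))).resolve_left hvQ

lemma eq_varIdeal_support_of_mem_associatedPrimes [Finite σ] {k : ℕ}
    {Q : Ideal (MvPolynomial σ K)}
    (hQ : Q ∈ associatedPrimes (MvPolynomial σ K) (MvPolynomial σ K ⧸ edgeIdeal K G ^ k))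
    (hVQ : ∀ v ∈ G.support, X v ∈ Q) : Q = varIdeal K G.support := by
  obtain ⟨hprime, f, hf⟩ := mem_associatedPrimes_quotient_iff.1 hQ
  refine le_antisymm (fun g hg => ?_) (varIdeal_le_iff.2 hVQ)
  refine mem_varIdeal_of_mul_mem (spannedByMonomials_edgeIdeal.pow k)
    (fun y hy => (idealFreeOfVar_edgeIdeal hy).pow k) (fun hfI => ?_)
    (fun v hv => (hf _).1 (hVQ v hv)) ((hf g).1 hg)
  exact hprime.ne_top ((Ideal.eq_top_iff_one _).2 ((hf 1).2 (by rwa [one_mul])))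

variable (K G) in
/-- The primes `P_{N(v)}`, for `v` a non-isolated vertex; they are the minimal primes of the edge
ideal. -/
def neighborPrimes : Set (Ideal (MvPolynomial σ K)) :=
  (fun v => varIdeal K (G.neighborSet v)) '' G.support

lemma varIdeal_support_notMem_neighborPrimes : varIdeal K G.support ∉ neighborPrimes K G := by
  rintro ⟨v, hv, h⟩
  have : (X v : MvPolynomial σ K) ∈ varIdeal K (G.neighborSet v) := by
    rw [show varIdeal K (G.neighborSet v) = _ from h]
    exact X_mem_varIdeal_iff.2 hv
  exact G.irrefl (X_mem_varIdeal_iff.1 this)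

lemma associatedPrimes_of_triangle [Finite σ] (hG : IsMultipartiteOnSupport G) {a b c : σ}
    (hab : G.Adj a b) (hbc : G.Adj b c) (hac : G.Adj a c) {k : ℕ} (hk : 2 ≤ k) :
    associatedPrimes (MvPolynomial σ K) (MvPolynomial σ K ⧸ edgeIdeal K G ^ k) =
      insert (varIdeal K G.support) (neighborPrimes K G) := by
  refine Set.Subset.antisymm (fun Q hQ => ?_) (Set.insert_subset ?_ ?_)
  · by_cases h : ∀ v ∈ G.support, X v ∈ Q
    · exact Or.inl (eq_varIdeal_support_of_mem_associatedPrimes hQ h)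
    · push Not at h
      obtain ⟨v, hv, hvQ⟩ := h
      exact Or.inr ⟨v, hv, (eq_varIdeal_neighborSet_of_mem_associatedPrimes hG hQ hv hvQ).symm⟩
  · exact varIdeal_support_mem_associatedPrimes hG hab hbc hac hk
  · rintro _ ⟨v, hv, rfl⟩
    exact varIdeal_neighborSet_mem_associatedPrimes hG hv (by omega)

variable (K G) in
/-- The `k`-th power of the edge ideal is the intersection of the `k`-th powers of the primes
`P_{N(v)}`; the reverse inclusion always holds. -/
def PowEqInf (k : ℕ) : Prop :=
  ∀ f, (∀ v ∈ G.support, f ∈ varIdeal K (G.neighborSet v) ^ k) → f ∈ edgeIdeal K G ^ k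

lemma powEqInf_one {a b : σ} (hab : G.Adj a b) : PowEqInf K G 1 := by
  classical
  intro f hf
  simp only [pow_one] at hf ⊢
  rw [f.as_sum]
  refine Ideal.sum_mem _ fun m hm => ?_
  obtain ⟨i, hi, hmi⟩ := mem_ideal_span_X_image.1 (hf a ⟨b, hab⟩) m hm
  obtain ⟨j, hj, hmj⟩ := mem_ideal_span_X_image.1 (hf i ⟨a, SimpleGraph.Adj.symm hi⟩) m hm
  have hij : i ≠ j := G.ne_of_adj hj
  refine Ideal.mem_of_dvd _ ?_ (X_mul_X_mem_edgeIdeal hj)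
  rw [X, X, monomial_mul, monomial_dvd_monomial]
  refine ⟨Or.inr fun v => ?_, by simp⟩
  simp only [Finsupp.add_apply, Finsupp.single_apply]
  grind

lemma weight_indicatorWeight_eq_zero {F : Set σ} {m : σ →₀ ℕ} (h : ∀ i ∈ m.support, i ∉ F) :
    Finsupp.weight (indicatorWeight F) m = 0 := by
  rw [Finsupp.weight_apply]
  exact Finset.sum_eq_zero fun i hi => by simp [indicatorWeight, h i hi]

/-- Without triangles the graph is complete bipartite on `N(a) ∪ N(b)`, so that the edge ideal is
the product of two prime ideals in disjoint sets of variables. -/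
lemma powEqInf_of_triangleFree (hG : IsMultipartiteOnSupport G)
    (hfree : ∀ a b c, G.Adj a b → G.Adj b c → ¬ G.Adj a c) {a b : σ} (hab : G.Adj a b) (k : ℕ) :
    PowEqInf K G k := by
  classical
  intro f hf
  have hprod : varIdeal K (G.neighborSet a) * varIdeal K (G.neighborSet b) ≤ edgeIdeal K G := by
    rw [varIdeal, varIdeal, Ideal.span_mul_span', Ideal.span_le]
    rintro _ ⟨_, ⟨u, hu, rfl⟩, _, ⟨w, hw, rfl⟩, rfl⟩
    have hu : G.Adj a u := hu
    have hw : G.Adj b w := hw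
    refine X_mul_X_mem_edgeIdeal ?_
    obtain h | h := hG ⟨b, hw.symm⟩ hu
    · exact absurd h.symm (hfree a b w hab hw)
    · exact h.symm
  have hprod := Ideal.pow_right_mono hprod k
  rw [mul_pow] at hprod
  rw [f.as_sum]
  refine Ideal.sum_mem _ fun m hm => hprod ?_
  have ha := weight_le_of_mem_varIdeal_pow (hf a ⟨b, hab⟩) hm
  have hb := weight_le_of_mem_varIdeal_pow (hf b ⟨a, hab.symm⟩) hm
  rw [← Finsupp.filter_add_filter_not m (· ∈ G.neighborSet a), map_add] at ha hb
  rw [weight_indicatorWeight_eq_zero (m := m.filter fun i => ¬ i ∈ G.neighborSet a)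
    (fun i hi => (Finset.mem_filter.1 hi).2), add_zero] at ha
  rw [weight_indicatorWeight_eq_zero (F := G.neighborSet b)
    (m := m.filter (· ∈ G.neighborSet a)) (fun i hi hib =>
    hfree a b i hab hib (Finset.mem_filter.1 hi).2), zero_add] at hb
  rw [← Finsupp.filter_add_filter_not m (· ∈ G.neighborSet a),
    ← mul_one (f.coeff _), ← monomial_mul]
  exact Ideal.mul_mem_mul (monomial_mem_varIdeal_pow _ _ ha) (monomial_mem_varIdeal_pow _ _ hb)

section Fintype

variable [Fintype σ]

variable (K G) in
open Classical in
/-- The sum of the variables at the non-isolated vertices. -/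
noncomputable def supportSum : MvPolynomial σ K :=
  ∑ v with v ∈ G.support, X v

lemma supportSum_mem_varIdeal : supportSum K G ∈ varIdeal K G.support := by
  classical
  exact Ideal.sum_mem _ fun _ hv => X_mem_varIdeal_iff.2 (Finset.mem_filter.1 hv).2

lemma PowEqInf.mem_of_supportSum_mul_mem (hG : IsMultipartiteOnSupport G) {k : ℕ}
    (hk : PowEqInf K G k) {f : MvPolynomial σ K}
    (hf : supportSum K G * f ∈ edgeIdeal K G ^ k) : f ∈ edgeIdeal K G ^ k := by
  classical
  refine hk f fun v hv => mem_varIdeal_pow_of_mul_mem (fun h => ?_)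
    (Ideal.pow_right_mono (edgeIdeal_le_varIdeal_neighborSet hG hv) _ hf)
  -- Evaluation at the `v`-th unit vector kills `P_{N(v)}`, but not the sum.
  have hker : varIdeal K (G.neighborSet v) ≤ RingHom.ker (eval (Pi.single v (1 : K))) :=
    varIdeal_le_iff.2 fun w hw => by
      rw [RingHom.mem_ker, eval_X, Pi.single_eq_of_ne (G.ne_of_adj hw).symm]
  have := hker h
  rw [RingHom.mem_ker, supportSum, map_sum] at this
  simp [Pi.single_apply, hv] at this

lemma PowEqInf.associatedPrimes_eq (hG : IsMultipartiteOnSupport G) {k : ℕ}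
    (hk : PowEqInf K G k) (hk1 : 1 ≤ k) :
    associatedPrimes (MvPolynomial σ K) (MvPolynomial σ K ⧸ edgeIdeal K G ^ k) =
      neighborPrimes K G := by
  refine Set.Subset.antisymm (fun Q hQ => ?_) ?_
  · by_cases h : ∀ v ∈ G.support, X v ∈ Q
    · obtain ⟨hprime, f, hf⟩ := mem_associatedPrimes_quotient_iff.1 hQ
      have hfI := hk.mem_of_supportSum_mul_mem hG
        ((hf _).1 (varIdeal_le_iff.2 h supportSum_mem_varIdeal))
      exact absurd ((Ideal.eq_top_iff_one _).2 ((hf 1).2 (by rwa [one_mul]))) hprime.ne_top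
    · push Not at h
      obtain ⟨v, hv, hvQ⟩ := h
      exact ⟨v, hv, (eq_varIdeal_neighborSet_of_mem_associatedPrimes hG hQ hv hvQ).symm⟩
  · rintro _ ⟨v, hv, rfl⟩
    exact varIdeal_neighborSet_mem_associatedPrimes hG hv hk1

variable (G) in
open Classical in
/-- The isolated vertices. -/
noncomputable def isolatedVerts : Finset σ := {v | v ∉ G.support}

lemma mem_isolatedVerts {v : σ} : v ∈ isolatedVerts G ↔ v ∉ G.support := by
  simp [isolatedVerts]

lemma varIdeal_isolatedVerts_le_ker {c : σ → K} (hc : ∀ v, v ∉ G.support → c v = 0) :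
    varIdeal K (isolatedVerts G : Set σ) ≤ RingHom.ker (lineSubst c) :=
  varIdeal_le_iff.2 fun v hv => by
    rw [RingHom.mem_ker, lineSubst_X, hc v (mem_isolatedVerts.1 hv), Polynomial.C_0, zero_mul]

lemma depth_of_triangle (hG : IsMultipartiteOnSupport G) {a b c : σ}
    (hab : G.Adj a b) (hbc : G.Adj b c) (hac : G.Adj a c) {k : ℕ} (hk : 2 ≤ k) :
    depth (idealOfVars σ K) (MvPolynomial σ K ⧸ edgeIdeal K G ^ k) = (isolatedVerts G).card := by
  classical
  rw [depth_quotient_eq_add_card (edgeIdeal_pow_le_idealOfVars (by omega)) (isolatedVerts G)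
    fun y hy => (idealFreeOfVar_edgeIdeal (mem_isolatedVerts.1 hy)).pow k]
  obtain ⟨j, rfl⟩ := Nat.exists_eq_add_of_le' hk
  rw [depth_quotient_eq_zero (u := X a * X b * X c * (X a * X b) ^ j), zero_add]
  · intro h
    obtain ⟨f, hf, g, hg, hfg⟩ := Submodule.mem_sup.1 h
    let γ : σ → K := G.support.indicator 1
    have hγ : ∀ v ∈ G.support, γ v = 1 := fun v hv => by simp [γ, hv]
    have hg0 : lineSubst γ g = 0 :=
      varIdeal_isolatedVerts_le_ker (fun v hv => by simp [γ, hv]) hg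
    have hd := X_pow_dvd_lineSubst γ (edgeIdeal_pow_le_idealOfVars_pow _ hf)
    have hfg := congrArg (lineSubst γ) hfg
    rw [map_add, hg0, add_zero, lineSubst_triangle (hγ a ⟨b, hab⟩) (hγ b ⟨a, hab.symm⟩)
      (hγ c ⟨a, hac.symm⟩)] at hfg
    rw [hfg] at hd
    exact not_X_pow_dvd_X_pow (by omega) hd
  · have h : idealOfVars σ K ≤ Submodule.colon (edgeIdeal K G ^ (j + 2) ⊔
        varIdeal K (isolatedVerts G : Set σ)) {X a * X b * X c * (X a * X b) ^ j} := by
      rw [← varIdeal_univ, varIdeal_le_iff]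
      refine fun v _ => Submodule.mem_colon_singleton.2 ?_
      by_cases hv : v ∈ G.support
      · exact Ideal.mem_sup_left (X_mul_triangle_mem_edgeIdeal_pow hG hab hbc hac hv j)
      · exact Ideal.mem_sup_right (Ideal.mul_mem_right _ _
          (X_mem_varIdeal_iff.2 (mem_isolatedVerts.2 hv)))
    exact fun r hr => Submodule.mem_colon_singleton.1 (h hr)

/-- If `I ^ k` is the intersection of the `P_{N(v)} ^ k`, then the sum `θ` of all non-isolated
variables is a nonzerodivisor modulo `I ^ k`. Modulo `θ` and the isolated variables the partial sum
over the part of a vertex `a`, times `(x_a x_b) ^ (k - 1)`, is a socle element. -/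
lemma PowEqInf.depth_eq (hG : IsMultipartiteOnSupport G) {a b : σ} (hab : G.Adj a b) {k : ℕ}
    (hk : PowEqInf K G k) (hk1 : 1 ≤ k) :
    depth (idealOfVars σ K) (MvPolynomial σ K ⧸ edgeIdeal K G ^ k) =
      (isolatedVerts G).card + 1 := by
  classical
  have hθm : supportSum K G ∈ idealOfVars σ K :=
    varIdeal_le_idealOfVars _ supportSum_mem_varIdeal
  have hle := edgeIdeal_pow_le_idealOfVars (K := K) (G := G) hk1
  rw [depth_quotient_eq_add_one (by rw [sup_eq_right.2 hle]; exact idealOfVars_ne_top) hθm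
      fun f hf => hk.mem_of_supportSum_mul_mem hG hf,
    depth_quotient_eq_add_card (sup_le hle ((Ideal.span_singleton_le_iff_mem _).2 hθm))
      (isolatedVerts G) fun y hy => ?_]
  swap
  · have hy := mem_isolatedVerts.1 hy
    refine ((idealFreeOfVar_edgeIdeal hy).pow k).sup ⟨{supportSum K G}, ?_, rfl⟩
    rintro _ rfl
    exact FreeOfVar.sum fun v hv => freeOfVar_X
      (by rintro rfl; exact hy (Finset.mem_filter.1 hv).2)
  obtain ⟨j, rfl⟩ := Nat.exists_eq_add_of_le' hk1
  let s₁ : MvPolynomial σ K := ∑ v with v ∈ G.support ∧ ¬ G.Adj a v, X v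
  let s₂ : MvPolynomial σ K := ∑ v with v ∈ G.support ∧ G.Adj a v, X v
  have hs : supportSum K G = s₂ + s₁ := by
    simp only [supportSum, s₁, s₂, ← Finset.filter_filter]
    exact (Finset.sum_filter_add_sum_filter_not _ _ _).symm
  have hw : ((X a * X b) ^ j : MvPolynomial σ K) ∈ edgeIdeal K G ^ j :=
    Ideal.pow_mem_pow (X_mul_X_mem_edgeIdeal hab) j
  rw [depth_quotient_eq_zero (u := s₁ * (X a * X b) ^ j), zero_add]
  · intro h
    obtain ⟨f', hf', g, hg, hfg⟩ := Submodule.mem_sup.1 h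
    obtain ⟨f, hf, θ', hθ', rfl⟩ := Submodule.mem_sup.1 hf'
    obtain ⟨r, rfl⟩ := Ideal.mem_span_singleton.1 hθ'
    -- The substitution `x_a ↦ t`, `x_b ↦ -t` sends the sum of all variables to zero.
    let γ : σ → K := Pi.single a 1 - Pi.single b 1
    have hne := G.ne_of_adj hab
    have hγa : γ a = 1 := by simp [γ, hne]
    have hγb : γ b = -1 := by simp [γ, hne.symm]
    have hγ : ∀ v, v ≠ a → v ≠ b → γ v = 0 := fun v h1 h2 => by simp [γ, h1, h2]
    have h₁ : lineSubst γ s₁ = Polynomial.X := by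
      rw [map_sum, Finset.sum_eq_single a]
      · rw [lineSubst_X, hγa, Polynomial.C_1, one_mul]
      · intro v hv hva
        rw [lineSubst_X, hγ v hva, Polynomial.C_0, zero_mul]
        rintro rfl
        exact (Finset.mem_filter.1 hv).2.2 hab
      · intro h
        exact absurd (Finset.mem_filter.2 ⟨Finset.mem_univ _, ⟨b, hab⟩, G.irrefl⟩) h
    have h₂ : lineSubst γ s₂ = -Polynomial.X := by
      rw [map_sum, Finset.sum_eq_single b]
      · rw [lineSubst_X, hγb]
        simp
      · intro v hv hvb
        rw [lineSubst_X, hγ v _ hvb, Polynomial.C_0, zero_mul]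
        rintro rfl
        exact G.irrefl (Finset.mem_filter.1 hv).2.2
      · intro h
        exact absurd (Finset.mem_filter.2 ⟨Finset.mem_univ _, ⟨a, hab.symm⟩, hab⟩) h
    have hg0 : lineSubst γ g = 0 := by
      refine varIdeal_isolatedVerts_le_ker (fun v hv => hγ v ?_ ?_) hg
      · rintro rfl
        exact hv ⟨b, hab⟩
      · rintro rfl
        exact hv ⟨a, hab.symm⟩
    have hd := X_pow_dvd_lineSubst γ (edgeIdeal_pow_le_idealOfVars_pow _ hf)
    have hfg := congrArg (lineSubst γ) hfg
    rw [map_add, map_add, hg0, add_zero, map_mul, hs, map_add, h₁, h₂, neg_add_cancel, zero_mul,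
      add_zero, map_mul, map_pow, map_mul, h₁, lineSubst_X, lineSubst_X, hγa, hγb] at hfg
    rw [hfg] at hd
    have hd := hd.mul_left ((-1) ^ j)
    have hsq : (-1 : Polynomial K) ^ j * (-1) ^ j = 1 := by rw [← mul_pow]; simp
    have : (-1 : Polynomial K) ^ j * (Polynomial.X * (Polynomial.C 1 * Polynomial.X *
        (Polynomial.C (-1) * Polynomial.X)) ^ j) = Polynomial.X ^ (2 * j + 1) := by
      rw [Polynomial.C_neg, Polynomial.C_1]
      linear_combination (Polynomial.X ^ (2 * j + 1)) * hsq
    rw [this] at hd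
    exact not_X_pow_dvd_X_pow (by omega) hd
  · have hmul : ∀ {v w}, G.Adj v w → X v * (X w * (X a * X b) ^ j) ∈ edgeIdeal K G ^ (j + 1) := by
      intro v w hvw
      rw [← mul_assoc, add_comm, pow_add, pow_one]
      exact Ideal.mul_mem_mul (X_mul_X_mem_edgeIdeal hvw) hw
    have h : idealOfVars σ K ≤ Submodule.colon (edgeIdeal K G ^ (j + 1) ⊔
        Ideal.span {supportSum K G} ⊔ varIdeal K (isolatedVerts G : Set σ))
        {s₁ * (X a * X b) ^ j} := by
      rw [← varIdeal_univ, varIdeal_le_iff]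
      refine fun v _ => Submodule.mem_colon_singleton.2 ?_
      by_cases hv : v ∈ G.support
      · refine Ideal.mem_sup_left ?_
        by_cases hav : G.Adj a v
        · refine Ideal.mem_sup_left ?_
          rw [smul_eq_mul, Finset.sum_mul, Finset.mul_sum]
          refine Ideal.sum_mem _ fun w hw => hmul ?_
          have hw := (Finset.mem_filter.1 hw).2
          exact ((hG hw.1 hav).resolve_left fun h => hw.2 h.symm).symm
        · have : (X v : MvPolynomial σ K) • (s₁ * (X a * X b) ^ j) = -(X v * (s₂ * (X a * X b) ^ j)) +
              supportSum K G * (X v * (X a * X b) ^ j) := by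
            rw [hs, smul_eq_mul]
            ring
          rw [this]
          refine Submodule.add_mem_sup (neg_mem ?_)
            (Ideal.mul_mem_right _ _ (Ideal.mem_span_singleton_self _))
          rw [Finset.sum_mul, Finset.mul_sum]
          refine Ideal.sum_mem _ fun w hw => hmul ?_
          have hw := (Finset.mem_filter.1 hw).2
          exact (hG hv hw.2).resolve_left fun h => hav h.symm
      · exact Ideal.mem_sup_right (Ideal.mul_mem_right _ _
          (X_mem_varIdeal_iff.2 (mem_isolatedVerts.2 hv)))
    exact fun r hr => Submodule.mem_colon_singleton.1 (h hr)

end Fintype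

end EdgeIdeals

/-! ### Matroidal ideals of degree two -/

section StabIndex

variable {α : Type*} {f : ℕ → α}

lemma stabIndex_eq_one (h : ∀ l, 1 ≤ l → f l = f 1) : stabIndex f = 1 := by
  refine le_antisymm (iInf₂_le_of_le 1 ⟨le_rfl, h⟩ (by simp)) (le_iInf₂ fun k hk => ?_)
  exact_mod_cast hk.1

lemma stabIndex_eq_two (h₁ : f 2 ≠ f 1) (h : ∀ l, 2 ≤ l → f l = f 2) : stabIndex f = 2 := by
  refine le_antisymm (iInf₂_le_of_le 2 ⟨by norm_num, h⟩ (by simp)) (le_iInf₂ fun k hk => ?_)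
  have : 2 ≤ k := by
    by_contra hlt
    obtain rfl : k = 1 := by have := hk.1; omega
    exact h₁ (hk.2 2 (by norm_num))
  exact_mod_cast this

end StabIndex

section Matroidal

variable {n : ℕ} {K : Type*} [Field K]

/-- The graph with an edge `uv` for each square-free monomial `x_u x_v` in `I`. -/
def graphOfIdeal (I : Ideal (MvPolynomial (Fin n) K)) : SimpleGraph (Fin n) where
  Adj u v := u ≠ v ∧ X u * X v ∈ I
  symm := ⟨fun _ _ h => ⟨h.1.symm, mul_comm (X _ : MvPolynomial (Fin n) K) _ ▸ h.2⟩⟩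
  loopless := ⟨fun _ h => h.1 rfl⟩

lemma exists_minGens_le {I : Ideal (MvPolynomial (Fin n) K)} {a : Fin n →₀ ℕ}
    (ha : monomial a 1 ∈ I) : ∃ b ∈ minGens I, b ≤ a := by
  obtain ⟨b, hb, hmin⟩ := exists_minimal_le_of_wellFoundedLT (fun b => monomial b (1 : K) ∈ I) a ha
  exact ⟨b, hmin, hb⟩

lemma monomial_mem_of_mem_minGens {I : Ideal (MvPolynomial (Fin n) K)} {a : Fin n →₀ ℕ}
    (ha : a ∈ minGens I) : monomial a 1 ∈ I :=
  Minimal.prop (P := fun b => monomial b (1 : K) ∈ I) ha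

lemma X_mul_X_eq_monomial (u v : Fin n) :
    (X u * X v : MvPolynomial (Fin n) K) =
      monomial (Finsupp.single u 1 + Finsupp.single v 1) 1 := by
  rw [X, X, monomial_mul, one_mul]

lemma IsMatroidal.exists_eq_single_add_single {I : Ideal (MvPolynomial (Fin n) K)}
    (hI : IsMatroidal I 2) {a : Fin n →₀ ℕ} (ha : a ∈ minGens I) :
    ∃ u v, u ≠ v ∧ a = Finsupp.single u 1 + Finsupp.single v 1 := by
  have hdeg := hI.degree_eq a ha
  have hsq := hI.squarefree a ha
  have hcard : a.support.card = 2 := by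
    rw [← hdeg, Finsupp.degree_apply, Finset.card_eq_sum_ones]
    refine Finset.sum_congr rfl fun i hi => ?_
    have := hsq i
    have := Finsupp.mem_support_iff.1 hi
    omega
  obtain ⟨u, v, huv, hs⟩ := Finset.card_eq_two.1 hcard
  refine ⟨u, v, huv, ?_⟩
  ext i
  have h1 : i ∈ a.support ↔ i = u ∨ i = v := by rw [hs]; simp
  rw [Finsupp.mem_support_iff] at h1
  have h2 := hsq i
  simp only [Finsupp.add_apply, Finsupp.single_apply]
  grind

lemma IsMatroidal.single_add_single_mem_minGens {I : Ideal (MvPolynomial (Fin n) K)}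
    (hI : IsMatroidal I 2) {u v : Fin n} (h : X u * X v ∈ I) :
    Finsupp.single u 1 + Finsupp.single v 1 ∈ minGens I := by
  rw [X_mul_X_eq_monomial] at h
  obtain ⟨b, hb, hle⟩ := exists_minGens_le h
  obtain ⟨c, hc⟩ := le_iff_exists_add.1 hle
  have hdeg := congrArg Finsupp.degree hc
  rw [map_add, map_add, hI.degree_eq b hb, Finsupp.degree_single, Finsupp.degree_single] at hdeg
  have hc0 : c = 0 := (Finsupp.degree_eq_zero_iff c).1 (by omega)
  rwa [hc, hc0, add_zero]

lemma IsMatroidal.eq_edgeIdeal {I : Ideal (MvPolynomial (Fin n) K)} (hI : IsMatroidal I 2) :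
    I = edgeIdeal K (graphOfIdeal I) := by
  refine le_antisymm ?_ (edgeIdeal_le_iff.2 fun u v h => h.2)
  have hmon : ∀ a, monomial a (1 : K) ∈ I → monomial a (1 : K) ∈ edgeIdeal K (graphOfIdeal I) := by
    intro a ha
    obtain ⟨b, hb, hle⟩ := exists_minGens_le ha
    obtain ⟨u, v, huv, rfl⟩ := hI.exists_eq_single_add_single hb
    refine Ideal.mem_of_dvd _ (monomial_dvd_monomial.2 ⟨Or.inr hle, one_dvd _⟩) ?_
    rw [← X_mul_X_eq_monomial]
    refine X_mul_X_mem_edgeIdeal ⟨huv, ?_⟩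
    rw [X_mul_X_eq_monomial]
    exact monomial_mem_of_mem_minGens hb
  obtain ⟨S, hS⟩ := hI.monomial_ideal
  conv_lhs => rw [hS]
  rw [Ideal.span_le]
  rintro _ ⟨a, ha, rfl⟩
  exact hmon a (by rw [hS]; exact Ideal.subset_span ⟨a, ha, rfl⟩)

/-- The exchange property for the generators `x_u x_u'` and `x_v x_w` replaces `u'` by `v` or
`w`. -/
lemma IsMatroidal.isMultipartiteOnSupport {I : Ideal (MvPolynomial (Fin n) K)}
    (hI : IsMatroidal I 2) : IsMultipartiteOnSupport (graphOfIdeal I) := by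
  rintro u v w ⟨u', huu', hmem⟩ hvw
  by_cases huv : u = v
  · exact Or.inr (huv ▸ hvw)
  by_cases huw : u = w
  · exact Or.inl (huw ▸ hvw.symm)
  by_cases hv : u' = v
  · exact Or.inl ⟨huv, hv ▸ hmem⟩
  by_cases hw : u' = w
  · exact Or.inr ⟨huw, hw ▸ hmem⟩
  obtain ⟨j, hj, hjI⟩ := hI.exchange _ (hI.single_add_single_mem_minGens hmem) _
    (hI.single_add_single_mem_minGens hvw.2) u' (by
      simp only [Finsupp.add_apply, Finsupp.single_apply]
      grind)
  rw [add_tsub_cancel_right, ← X_mul_X_eq_monomial] at hjI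
  have : j = v ∨ j = w := by
    simp only [Finsupp.add_apply, Finsupp.single_apply] at hj
    grind
  obtain rfl | rfl := this
  · exact Or.inl ⟨huv, hjI⟩
  · exact Or.inr ⟨huw, hjI⟩

/-- Both indices are `1` when the graph has no edge or no triangle, and `2` otherwise. -/
theorem astab_eq_dstab_edgeIdeal {G : SimpleGraph (Fin n)} (hG : IsMultipartiteOnSupport G) :
    astab (edgeIdeal K G) = dstab (edgeIdeal K G) ∧ dstab (edgeIdeal K G) ≤ 2 := by
  by_cases hedge : ∃ a b, G.Adj a b
  · obtain ⟨a, b, hab⟩ := hedge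
    by_cases hfree : ∀ a b c, G.Adj a b → G.Adj b c → ¬ G.Adj a c
    · have hk := powEqInf_of_triangleFree (K := K) hG hfree hab
      have h₁ : astab (edgeIdeal K G) = 1 := stabIndex_eq_one fun l hl => by
        rw [(hk l).associatedPrimes_eq hG hl, (hk 1).associatedPrimes_eq hG le_rfl]
      have h₂ : dstab (edgeIdeal K G) = 1 := stabIndex_eq_one fun l hl =>
        ((hk l).depth_eq hG hab hl).trans ((hk 1).depth_eq hG hab le_rfl).symm
      rw [h₁, h₂]
      exact ⟨rfl, by norm_num⟩
    · push Not at hfree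
      obtain ⟨a, b, c, hab, hbc, hac⟩ := hfree
      have hk := powEqInf_one (K := K) hab
      have h₁ : astab (edgeIdeal K G) = 2 := by
        refine stabIndex_eq_two (fun h => ?_) fun l hl => ?_
        · rw [associatedPrimes_of_triangle hG hab hbc hac le_rfl,
            hk.associatedPrimes_eq hG le_rfl] at h
          exact varIdeal_support_notMem_neighborPrimes (h ▸ Set.mem_insert _ _)
        · rw [associatedPrimes_of_triangle hG hab hbc hac hl,
            associatedPrimes_of_triangle hG hab hbc hac le_rfl]
      have h₂ : dstab (edgeIdeal K G) = 2 := by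
        refine stabIndex_eq_two (fun h => ?_) fun l hl =>
          (depth_of_triangle hG hab hbc hac hl).trans
            (depth_of_triangle hG hab hbc hac le_rfl).symm
        have h := ((depth_of_triangle hG hab hbc hac le_rfl).symm.trans h).trans
          (hk.depth_eq hG hab le_rfl)
        norm_cast at h
        omega
      rw [h₁, h₂]
      exact ⟨rfl, le_rfl⟩
  · -- Without edges the ideal is zero, and so are all its powers.
    have h0 : edgeIdeal K G = ⊥ := by
      rw [eq_bot_iff, edgeIdeal_le_iff]
      exact fun u v huv => absurd ⟨u, v, huv⟩ hedge
    have hpow : ∀ l, 1 ≤ l → edgeIdeal K G ^ l = edgeIdeal K G ^ 1 := fun l hl => by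
      rw [h0, pow_one, Ideal.bot_pow (by omega)]
    have h₁ : astab (edgeIdeal K G) = 1 := stabIndex_eq_one fun l hl => by rw [hpow l hl]
    have h₂ : dstab (edgeIdeal K G) = 1 := stabIndex_eq_one fun l hl => by rw [hpow l hl]
    rw [h₁, h₂]
    exact ⟨rfl, by norm_num⟩

end Matroidal

end PolymatroidalStability

theorem mainTheorem9 {n : ℕ} {K : Type*} [Field K] (I : Ideal (MvPolynomial (Fin n) K))
    (hI : PolymatroidalStability.IsMatroidal I 2) :
    PolymatroidalStability.astab I = PolymatroidalStability.dstab I ∧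
      PolymatroidalStability.dstab I ≤ 2 := by
  rw [hI.eq_edgeIdeal]
  exact PolymatroidalStability.astab_eq_dstab_edgeIdeal hI.isMultipartiteOnSupport
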